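/- For $\alpha>0$ let $\omega_\alpha(x)=(1-x^2)^\alpha$ on $[-1,1]$, and for $c>0$ let $$\mathcal L_c^{(\alpha)}f(x)=-\frac1{\omega_\alpha(x)}\frac{d}{dx}\bigl[\omega_\alpha(x)(1-x^2)f'(x)\bigr]+c^2x^2f(x),\qquad -1<x<1.$$ Its eigenfunctions are the functions $f\in C^2([-1,1])$, $f\neq 0$, with $\mathcal L_c^{(\alpha)}f=\chi f$ on $(-1,1)$ for some real $\chi$; the eigenvalues are simple and are written in increasing order as $\chi_0^\alpha(c)<\chi_1^\alpha(c)<\cdots$. For $n\ge 0$ let $\psi_{n,c}^{(\alpha)}$, the $n$-th generalized prolate spheroidal wave function, be the eigenfunction for $\chi_n^\alpha(c)$ with $\int_{-1}^1|\psi_{n,c}^{(\alpha)}|^2\omega_\alpha=1$ (unique up to sign). Let $$\widetilde P_k=\frac1{\sqrt{h_k}}P_k^{(\alpha,\alpha)},\qquad h_k=\frac{2^{2\alpha+1}\Gamma(k+\alpha+1)^2}{k!\,(2k+2\alpha+1)\,\Gamma(k+2\alpha+1)},$$ be the normalized Jacobi polynomials, an orthonormal basis of $L^2([-1,1],\omega_\alpha)$,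 and let $\beta_k^n=\int_{-1}^1\psi_{n,c}^{(\alpha)}(x)\,\widetilde P_k(x)\,\omega_\alpha(x)\,dx$ be the coefficients of $\psi_{n,c}^{(\alpha)}$ in this basis. Put $$m_\alpha=4.13\Bigl(1.28+\frac{2\alpha+1}{1.9}\Bigr)^{0.55}.$$ Lemma. There is a constant $\delta>0$ such that for all real $c>1$ and $\alpha>0$ there is a constant $C_{c,\alpha}>0$, depending only on $c$ and $\alpha$, such that for all integers $n,k\ge 0$ with $k\le n/1.9$ and $n\ge m_\alpha c$, $$|\beta_k^n|\le C_{c,\alpha}\,e^{-\delta n}.$$ -/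

import Mathlib

noncomputable section

namespace GPSWF

/-- The Gegenbauer weight `ω_α(x) = (1 - x²)^α` on `[-1, 1]`. -/
def weight (α x : ℝ) : ℝ := (1 - x ^ 2) ^ α

/-- The Sturm-Liouville operator
`L f = -(1 / ω_α) (ω_α (1 - x²) f')' + c² x² f`, at points of `(-1, 1)`. -/
def sturmLiouville (c α : ℝ) (f : ℝ → ℝ) (x : ℝ) : ℝ :=
  -(1 / weight α x) * deriv (fun t => weight α t * (1 - t ^ 2) * deriv f t) x
    + c ^ 2 * x ^ 2 * f x

/-- `f` is an eigenfunction of the Sturm-Liouville operator with eigenvalue `χ`. As `x = ± 1` are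
singular points of the equation, the boundary condition is regularity: `f` is twice continuously
differentiable up to the end points. -/
structure IsEigenfunction (c α χ : ℝ) (f : ℝ → ℝ) : Prop where
  contDiffOn : ContDiffOn ℝ 2 f (Set.Icc (-1) 1)
  ne_zero : ∃ x ∈ Set.Icc (-1 : ℝ) 1, f x ≠ 0
  eigen : ∀ x ∈ Set.Ioo (-1 : ℝ) 1, sturmLiouville c α f x = χ * f x

/-- The set of eigenvalues of the Sturm-Liouville operator (for `α > 0` they are all real and
simple, so that counting them needs no multiplicities). -/
def eigenvalues (c α : ℝ) : Set ℝ := {χ | ∃ f : ℝ → ℝ, IsEigenfunction c α χ f}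

/-- `χ` is the `(n+1)`-th eigenvalue `χ_n` of the Sturm-Liouville operator in increasing order:
it is an eigenvalue, and exactly `n` eigenvalues lie below it. -/
def IsNthEigenvalue (c α : ℝ) (n : ℕ) (χ : ℝ) : Prop :=
  χ ∈ eigenvalues c α ∧ {χ' | χ' ∈ eigenvalues c α ∧ χ' < χ}.encard = n

/-- `ψ` is the `n`-th generalized prolate spheroidal wave function: the eigenfunction for the
eigenvalue `χ_n`, with norm one in `L²([-1, 1], ω_α)`. This determines `ψ` on `[-1, 1]` up to
its sign. -/
def IsGPSWF (c α : ℝ) (n : ℕ) (ψ : ℝ → ℝ) : Prop :=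
  (∃ χ : ℝ, IsNthEigenvalue c α n χ ∧ IsEigenfunction c α χ ψ) ∧
    ∫ x in (-1 : ℝ)..1, ψ x ^ 2 * weight α x = 1

/-- The Jacobi polynomial
`P_k^{(α,β)}(x) = ∑_{l ≤ k} (k+α+β+1)_l (α+l+1)_{k-l} / (l! (k-l)!) ((x-1)/2)^l`,
where `(a)_l = a (a+1) ⋯ (a+l-1)`. -/
def jacobiP (α β : ℝ) (k : ℕ) (x : ℝ) : ℝ :=
  ∑ l ∈ Finset.range (k + 1),
    (ascPochhammer ℝ l).eval ((k : ℝ) + α + β + 1) *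
        (ascPochhammer ℝ (k - l)).eval (α + (l : ℝ) + 1) /
      ((l.factorial : ℝ) * ((k - l).factorial : ℝ)) * ((x - 1) / 2) ^ l

/-- The squared norm `h_k` of `P_k^{(α,α)}` in `L²([-1, 1], ω_α)`. -/
def jacobiNormSq (α : ℝ) (k : ℕ) : ℝ :=
  (2 : ℝ) ^ (2 * α + 1) * Real.Gamma ((k : ℝ) + α + 1) ^ 2 /
    ((k.factorial : ℝ) * (2 * (k : ℝ) + 2 * α + 1) * Real.Gamma ((k : ℝ) + 2 * α + 1))

/-- The normalized Jacobi polynomial `P_k^{(α,α)} / √h_k`. -/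
def normalizedJacobi (α : ℝ) (k : ℕ) (x : ℝ) : ℝ :=
  1 / Real.sqrt (jacobiNormSq α k) * jacobiP α α k x

/-- The `k`-th coefficient of `f` in the orthonormal basis of normalized Jacobi polynomials of
`L²([-1, 1], ω_α)`. -/
def jacobiCoeff (α : ℝ) (k : ℕ) (f : ℝ → ℝ) : ℝ :=
  ∫ x in (-1 : ℝ)..1, f x * normalizedJacobi α k x * weight α x

/-- The constant `m_α`. -/
def mConst (α : ℝ) : ℝ := 4.13 * (1.28 + (2 * α + 1) / 1.9) ^ (0.55 : ℝ)

end GPSWF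

end

noncomputable section

namespace GPSWF

open Set MeasureTheory Polynomial

/-! The operator is the Jacobi operator J plus the nonnegative potential c²x². J has eigenvalues λ_k
= k(k+2α+1) on the normalized Jacobi polynomials. Two facts suffice.

Min-max gives χ_n ≥ λ_n (`IsNthEigenvalue.jacobiEigenvalue_le`): some nonzero combination of the n+1
lowest eigenfunctions is orthogonal to all polynomials of degree < n.

Let S_k be the sum of the squared coefficients of ψ up to index k. Testing the equation against the
truncation p of ψ at degree k gives (χ - λ_k) S_k ≤ c² ⟨ψ, x²p⟩. As x²p has degree at most k+2 and
norm at most √S_k, it follows that (χ - λ_k)² S_k ≤ c⁴ S_{k+2}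
(`IsEigenfunction.sum_jacobiCoeff_sq_le`).

For k < n the gap χ_n - λ_k is at least n. So once n ≥ 3c², lowering k by 2 divides S_k by at least
9 ≥ e². Starting from Bessel's S ≤ 1 near index n, this yields |β_k| ≤ exp(-(n-k)/2). The finitely
many n < 3c² are absorbed in the constant. -/

/-! ### The weighted inner product. -/

/-- The inner product `∫ f g ω_α` over `[-1, 1]`. -/
def ip (α : ℝ) (f g : ℝ → ℝ) : ℝ := ∫ x in (-1 : ℝ)..1, f x * g x * weight α x

lemma one_sub_sq_pos {x : ℝ} (hx : x ∈ Ioo (-1 : ℝ) 1) : 0 < 1 - x ^ 2 := by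
  nlinarith [hx.1, hx.2]

lemma continuous_weight {α : ℝ} (hα : 0 ≤ α) : Continuous (weight α) :=
  (by fun_prop : Continuous fun x : ℝ => 1 - x ^ 2).rpow_const fun _ => Or.inr hα

lemma weight_pos {α x : ℝ} (hx : x ∈ Ioo (-1 : ℝ) 1) : 0 < weight α x :=
  Real.rpow_pos_of_pos (one_sub_sq_pos hx) α

lemma intervalIntegrable_mul_weight {α : ℝ} (hα : 0 ≤ α) {f g : ℝ → ℝ}
    (hf : ContinuousOn f (Icc (-1) 1)) (hg : ContinuousOn g (Icc (-1) 1)) :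
    IntervalIntegrable (fun x => f x * g x * weight α x) volume (-1) 1 :=
  ((hf.mul hg).mul (continuous_weight hα).continuousOn).intervalIntegrable_of_Icc (by norm_num)

lemma ip_comm (α : ℝ) (f g : ℝ → ℝ) : ip α f g = ip α g f := by
  simp only [ip, mul_comm (f _) (g _)]

lemma ip_congr {α : ℝ} {f g f' g' : ℝ → ℝ}
    (h : ∀ x ∈ Ioo (-1 : ℝ) 1, f x * g x = f' x * g' x) : ip α f g = ip α f' g' :=
  intervalIntegral.integral_congr_Ioo_of_le (by norm_num) fun x hx => by simp only [h x hx]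

lemma ip_smul_left (α a : ℝ) (f g : ℝ → ℝ) : ip α (fun x => a * f x) g = a * ip α f g := by
  simp only [ip, ← intervalIntegral.integral_const_mul]
  congr 1; ext x; ring

lemma ip_smul_right (α a : ℝ) (f g : ℝ → ℝ) : ip α f (fun x => a * g x) = a * ip α f g := by
  rw [ip_comm, ip_smul_left, ip_comm]

lemma ip_sub_left {α : ℝ} (hα : 0 ≤ α) {f g h : ℝ → ℝ} (hf : ContinuousOn f (Icc (-1) 1))
    (hg : ContinuousOn g (Icc (-1) 1)) (hh : ContinuousOn h (Icc (-1) 1)) :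
    ip α (fun x => f x - g x) h = ip α f h - ip α g h := by
  simp only [ip]
  rw [← intervalIntegral.integral_sub (intervalIntegrable_mul_weight hα hf hh)
    (intervalIntegrable_mul_weight hα hg hh)]
  congr 1; ext x; ring

lemma ip_sub_right {α : ℝ} (hα : 0 ≤ α) {f g h : ℝ → ℝ} (hf : ContinuousOn f (Icc (-1) 1))
    (hg : ContinuousOn g (Icc (-1) 1)) (hh : ContinuousOn h (Icc (-1) 1)) :
    ip α h (fun x => f x - g x) = ip α h f - ip α h g := by
  rw [ip_comm, ip_sub_left hα hf hg hh, ip_comm α f, ip_comm α g]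

lemma ip_sum_left {α : ℝ} (hα : 0 ≤ α) {ι : Type*} (s : Finset ι) (a : ι → ℝ) (f : ι → ℝ → ℝ)
    {g : ℝ → ℝ} (hf : ∀ i ∈ s, ContinuousOn (f i) (Icc (-1) 1))
    (hg : ContinuousOn g (Icc (-1) 1)) :
    ip α (fun x => ∑ i ∈ s, a i * f i x) g = ∑ i ∈ s, a i * ip α (f i) g := by
  simp only [ip, ← intervalIntegral.integral_const_mul]
  rw [← intervalIntegral.integral_finsetSum fun i hi =>
    (intervalIntegrable_mul_weight hα (hf i hi) hg).const_mul (a i)]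
  congr 1; ext x
  rw [Finset.sum_mul, Finset.sum_mul]
  exact Finset.sum_congr rfl fun i _ => by ring

lemma ip_sum_right {α : ℝ} (hα : 0 ≤ α) {ι : Type*} (s : Finset ι) (a : ι → ℝ) (f : ι → ℝ → ℝ)
    {g : ℝ → ℝ} (hf : ∀ i ∈ s, ContinuousOn (f i) (Icc (-1) 1))
    (hg : ContinuousOn g (Icc (-1) 1)) :
    ip α g (fun x => ∑ i ∈ s, a i * f i x) = ∑ i ∈ s, a i * ip α g (f i) := by
  rw [ip_comm, ip_sum_left hα s a f hf hg]
  simp only [ip_comm α g]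

lemma ip_le_ip {α : ℝ} (hα : 0 ≤ α) {f g f' g' : ℝ → ℝ} (hf : ContinuousOn f (Icc (-1) 1))
    (hg : ContinuousOn g (Icc (-1) 1)) (hf' : ContinuousOn f' (Icc (-1) 1))
    (hg' : ContinuousOn g' (Icc (-1) 1))
    (h : ∀ x ∈ Ioo (-1 : ℝ) 1, f x * g x ≤ f' x * g' x) : ip α f g ≤ ip α f' g' :=
  intervalIntegral.integral_mono_on_of_le_Ioo (by norm_num)
    (intervalIntegrable_mul_weight hα hf hg)
    (intervalIntegrable_mul_weight hα hf' hg')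
    fun x hx => mul_le_mul_of_nonneg_right (h x hx) (weight_pos hx).le

lemma ip_self_nonneg {α : ℝ} (hα : 0 ≤ α) {f : ℝ → ℝ} (hf : ContinuousOn f (Icc (-1) 1)) :
    0 ≤ ip α f f := by
  have := ip_le_ip hα (continuousOn_const (c := (0 : ℝ))) (continuousOn_const (c := (0 : ℝ))) hf hf
    fun x _ => by nlinarith [mul_self_nonneg (f x)]
  simpa [ip] using this

/-- The Cauchy-Schwarz inequality. -/
lemma ip_sq_le {α : ℝ} (hα : 0 ≤ α) {f g : ℝ → ℝ} (hf : ContinuousOn f (Icc (-1) 1))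
    (hg : ContinuousOn g (Icc (-1) 1)) : ip α f g ^ 2 ≤ ip α f f * ip α g g := by
  have key : ∀ t : ℝ, 0 ≤ ip α g g * (t * t) + (-2 * ip α f g) * t + ip α f f := by
    intro t
    have hc : ContinuousOn (fun x => t * g x) (Icc (-1) 1) := continuousOn_const.mul hg
    have hs : ContinuousOn (fun x => f x - t * g x) (Icc (-1) 1) := hf.sub hc
    have h := ip_self_nonneg hα hs
    have e : ip α (fun x => f x - t * g x) (fun x => f x - t * g x) =
        ip α g g * (t * t) + (-2 * ip α f g) * t + ip α f f := by
      rw [ip_sub_left hα hf hc hs, ip_sub_right hα hf hc hf, ip_sub_right hα hf hc hc,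
        ip_smul_left, ip_smul_left, ip_smul_right, ip_smul_right, ip_comm α g f]
      ring
    exact e ▸ h
  have := discrim_le_zero key
  unfold discrim at this
  nlinarith

lemma ip_self_pos {α : ℝ} (hα : 0 ≤ α) {f : ℝ → ℝ} (hf : ContinuousOn f (Icc (-1) 1))
    (hne : ∃ x ∈ Icc (-1 : ℝ) 1, f x ≠ 0) : 0 < ip α f f := by
  -- The given point may be an end point, where the weight can vanish; continuity supplies an
  -- interior one.
  obtain ⟨y, hy, hfy⟩ : ∃ y ∈ Ioo (-1 : ℝ) 1, f y ≠ 0 := by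
    by_contra! h
    obtain ⟨x, hx, hfx⟩ := hne
    refine hfx ?_
    have hcl : closure (Ioo (-1 : ℝ) 1) = Icc (-1) 1 := closure_Ioo (by norm_num)
    have : EqOn f (fun _ => 0) (Icc (-1) 1) :=
      EqOn.of_subset_closure (s := Ioo (-1 : ℝ) 1) h hf continuousOn_const Ioo_subset_Icc_self hcl.ge
    exact this hx
  refine intervalIntegral.integral_pos (by norm_num)
    ((hf.mul hf).mul (continuous_weight hα).continuousOn) ?_ ⟨y, Ioo_subset_Icc_self hy, ?_⟩
  · intro x hx
    refine mul_nonneg (mul_self_nonneg _) (Real.rpow_nonneg ?_ _)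
    nlinarith [hx.1, hx.2]
  · exact mul_pos (mul_self_pos.2 hfy) (weight_pos hy)

/-! ### The Jacobi operator and its symmetry. -/

/-- `f` is twice differentiable on `(-1, 1)` with derivatives `f₁`, `f₂`, all continuous up to
the end points. -/
structure HasC2 (f f₁ f₂ : ℝ → ℝ) : Prop where
  cont : ContinuousOn f (Icc (-1) 1)
  cont₁ : ContinuousOn f₁ (Icc (-1) 1)
  cont₂ : ContinuousOn f₂ (Icc (-1) 1)
  deriv₁ : ∀ x ∈ Ioo (-1 : ℝ) 1, HasDerivAt f (f₁ x) x
  deriv₂ : ∀ x ∈ Ioo (-1 : ℝ) 1, HasDerivAt f₁ (f₂ x) x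

lemma HasC2.sum {ι : Type*} (s : Finset ι) (a : ι → ℝ) {f f₁ f₂ : ι → ℝ → ℝ}
    (h : ∀ i, HasC2 (f i) (f₁ i) (f₂ i)) :
    HasC2 (fun x => ∑ i ∈ s, a i * f i x) (fun x => ∑ i ∈ s, a i * f₁ i x)
      (fun x => ∑ i ∈ s, a i * f₂ i x) where
  cont := continuousOn_finsetSum _ fun i _ => continuousOn_const.mul (h i).cont
  cont₁ := continuousOn_finsetSum _ fun i _ => continuousOn_const.mul (h i).cont₁
  cont₂ := continuousOn_finsetSum _ fun i _ => continuousOn_const.mul (h i).cont₂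
  deriv₁ x hx := HasDerivAt.fun_sum fun i _ => ((h i).deriv₁ x hx).const_mul _
  deriv₂ x hx := HasDerivAt.fun_sum fun i _ => ((h i).deriv₂ x hx).const_mul _

lemma hasC2_polynomial (p : Polynomial ℝ) :
    HasC2 (fun x => p.eval x) (fun x => p.derivative.eval x)
      (fun x => p.derivative.derivative.eval x) where
  cont := p.continuous.continuousOn
  cont₁ := p.derivative.continuous.continuousOn
  cont₂ := p.derivative.derivative.continuous.continuousOn
  deriv₁ x _ := p.hasDerivAt x
  deriv₂ x _ := p.derivative.hasDerivAt x

/-- The Jacobi operator `-(1 - x²) f'' + 2 (α + 1) x f'` in terms of the derivatives of `f`. -/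
def jacobiOp (α : ℝ) (f₁ f₂ : ℝ → ℝ) (x : ℝ) : ℝ :=
  -(1 - x ^ 2) * f₂ x + 2 * (α + 1) * x * f₁ x

lemma continuousOn_jacobiOp (α : ℝ) {f f₁ f₂ : ℝ → ℝ} (h : HasC2 f f₁ f₂) :
    ContinuousOn (jacobiOp α f₁ f₂) (Icc (-1) 1) :=
  ((by fun_prop : ContinuousOn (fun x : ℝ => -(1 - x ^ 2)) (Icc (-1) 1)).mul h.cont₂).add
    ((by fun_prop : ContinuousOn (fun x : ℝ => 2 * (α + 1) * x) (Icc (-1) 1)).mul h.cont₁)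

lemma hasDerivAt_weight_mul (α : ℝ) {x : ℝ} (hx : x ∈ Ioo (-1 : ℝ) 1) {u : ℝ → ℝ} {u' : ℝ}
    (hu : HasDerivAt u u' x) :
    HasDerivAt (fun t => weight α t * (1 - t ^ 2) * u t)
      (weight α x * ((1 - x ^ 2) * u' - 2 * (α + 1) * x * u x)) x := by
  have h0 := one_sub_sq_pos hx
  have h1 : HasDerivAt (fun t : ℝ => 1 - t ^ 2) (-(2 * x)) x := by
    simpa using (hasDerivAt_pow 2 x).const_sub 1
  have h2 := h1.rpow_const (p := α) (Or.inl h0.ne')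
  have h3 := (h2.mul h1).mul hu
  have e : (1 - x ^ 2) ^ (α - 1) * (1 - x ^ 2) = (1 - x ^ 2) ^ α := by
    rw [← Real.rpow_add_one h0.ne']; ring_nf
  have h4 : HasDerivAt (fun t => weight α t * (1 - t ^ 2) * u t) _ x := h3
  convert h4 using 1
  simp only [weight, Pi.mul_apply]
  linear_combination (2 * x * α * u x) * e

/-- Integration by parts: the boundary terms carry ω_α(1-x²) = ω_{α+1}, which vanishes at ±1. The
right side is symmetric in f and g. -/
lemma ip_jacobiOp {α : ℝ} (hα : 0 ≤ α) {f f₁ f₂ g g₁ g₂ : ℝ → ℝ} (hf : HasC2 f f₁ f₂)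
    (hg : HasC2 g g₁ g₂) :
    ip α (jacobiOp α f₁ f₂) g = ip (α + 1) f₁ g₁ := by
  have hw := (continuous_weight hα).continuousOn (s := Icc (-1 : ℝ) 1)
  have hs : ContinuousOn (fun x : ℝ => 1 - x ^ 2) (Icc (-1) 1) := by fun_prop
  have hI1 := intervalIntegrable_mul_weight hα (continuousOn_jacobiOp α hf) hg.cont
  have hI2 := intervalIntegrable_mul_weight (α := α + 1) (by linarith) hf.cont₁ hg.cont₁
  have h := intervalIntegral.integral_eq_sub_of_hasDerivAt_of_le (a := (-1 : ℝ)) (b := 1)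
    (f := fun t => weight α t * (1 - t ^ 2) * f₁ t * g t)
    (f' := fun x => f₁ x * g₁ x * weight (α + 1) x - jacobiOp α f₁ f₂ x * g x * weight α x)
    (by norm_num) (((hw.mul hs).mul hf.cont₁).mul hg.cont) (fun x hx => by
      have := (hasDerivAt_weight_mul α hx (hf.deriv₂ x hx)).mul (hg.deriv₁ x hx)
      refine HasDerivAt.congr_deriv (f := fun t => weight α t * (1 - t ^ 2) * f₁ t * g t) this ?_
      have e : weight (α + 1) x = weight α x * (1 - x ^ 2) :=
        Real.rpow_add_one (one_sub_sq_pos hx).ne' α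
      rw [e, jacobiOp]; ring) (hI2.sub hI1)
  rw [intervalIntegral.integral_sub hI2 hI1] at h
  norm_num at h
  simp only [ip]
  linarith

lemma ip_jacobiOp_comm {α : ℝ} (hα : 0 ≤ α) {f f₁ f₂ g g₁ g₂ : ℝ → ℝ} (hf : HasC2 f f₁ f₂)
    (hg : HasC2 g g₁ g₂) :
    ip α (jacobiOp α f₁ f₂) g = ip α f (jacobiOp α g₁ g₂) := by
  rw [ip_jacobiOp hα hf hg, ip_comm α f, ip_jacobiOp hα hg hf, ip_comm]

/-- Derivatives within the closed interval are used, as they stay continuous up to ±1; dividing by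
ω_α removes the weight from the equation. -/
lemma IsEigenfunction.hasC2 {c α χ : ℝ} {f : ℝ → ℝ} (h : IsEigenfunction c α χ f) :
    ∃ f₁ f₂ : ℝ → ℝ, HasC2 f f₁ f₂ ∧
      ∀ x ∈ Ioo (-1 : ℝ) 1, jacobiOp α f₁ f₂ x = (χ - c ^ 2 * x ^ 2) * f x := by
  have hu : UniqueDiffOn ℝ (Icc (-1 : ℝ) 1) := uniqueDiffOn_Icc (by norm_num)
  have hd1 : ContDiffOn ℝ 1 (derivWithin f (Icc (-1) 1)) (Icc (-1) 1) :=
    h.contDiffOn.derivWithin hu (by norm_num)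
  have hd2 : ContDiffOn ℝ 0 (derivWithin (derivWithin f (Icc (-1) 1)) (Icc (-1) 1)) (Icc (-1) 1) :=
    hd1.derivWithin hu (by norm_num)
  have D1 : ∀ x ∈ Ioo (-1 : ℝ) 1, HasDerivAt f (derivWithin f (Icc (-1) 1) x) x := fun x hx =>
    ((h.contDiffOn.differentiableOn (by norm_num)) x
      (Ioo_subset_Icc_self hx)).hasDerivWithinAt.hasDerivAt (Icc_mem_nhds hx.1 hx.2)
  have D2 : ∀ x ∈ Ioo (-1 : ℝ) 1, HasDerivAt (derivWithin f (Icc (-1) 1))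
      (derivWithin (derivWithin f (Icc (-1) 1)) (Icc (-1) 1) x) x := fun x hx =>
    ((hd1.differentiableOn (by norm_num)) x
      (Ioo_subset_Icc_self hx)).hasDerivWithinAt.hasDerivAt (Icc_mem_nhds hx.1 hx.2)
  refine ⟨_, _, ⟨h.contDiffOn.continuousOn, hd1.continuousOn, hd2.continuousOn, D1, D2⟩,
    fun x hx => ?_⟩
  have he := h.eigen x hx
  have hev : (fun t => weight α t * (1 - t ^ 2) * deriv f t) =ᶠ[nhds x]
      fun t => weight α t * (1 - t ^ 2) * derivWithin f (Icc (-1) 1) t := by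
    filter_upwards [Ioo_mem_nhds hx.1 hx.2] with t ht
    rw [(D1 t ht).deriv]
  rw [sturmLiouville, hev.deriv_eq, (hasDerivAt_weight_mul α hx (D2 x hx)).deriv] at he
  have hw := (weight_pos (α := α) hx).ne'
  rw [neg_mul, ← mul_assoc, one_div_mul_cancel hw, one_mul] at he
  rw [jacobiOp]
  linarith

/-! ### Jacobi polynomials: differential equation, orthogonality, norms. -/

/-- The coefficients of `P_k^{(α,α)}` in powers of `(x - 1) / 2`. -/
def jacobiShiftedCoeff (α : ℝ) (k l : ℕ) : ℝ :=
  if l < k + 1 then (ascPochhammer ℝ l).eval ((k : ℝ) + α + α + 1) *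
    (ascPochhammer ℝ (k - l)).eval (α + (l : ℝ) + 1) /
      ((l.factorial : ℝ) * ((k - l).factorial : ℝ)) else 0

/-- `P_k^{(α,α)}` as a polynomial in `(x - 1) / 2`. -/
def jacobiShifted (α : ℝ) (k : ℕ) : ℝ[X] :=
  ∑ l ∈ Finset.range (k + 1), C (jacobiShiftedCoeff α k l) * X ^ l

/-- `P_k^{(α,α)}` as a polynomial. -/
def jacobiPoly (α : ℝ) (k : ℕ) : ℝ[X] := (jacobiShifted α k).comp (C (1 / 2) * (X - 1))

lemma jacobiPoly_eval (α : ℝ) (k : ℕ) (x : ℝ) : (jacobiPoly α k).eval x = jacobiP α α k x := by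
  simp only [jacobiPoly, jacobiShifted, jacobiP, eval_comp, eval_finsetSum]
  refine Finset.sum_congr rfl fun l hl => ?_
  simp only [jacobiShiftedCoeff, if_pos (Finset.mem_range.1 hl), eval_mul, eval_C, eval_pow, eval_sub,
    eval_X, eval_one, one_div_mul_eq_div]

lemma jacobiShifted_coeff (α : ℝ) (k l : ℕ) :
    (jacobiShifted α k).coeff l = jacobiShiftedCoeff α k l := by
  simp only [jacobiShifted, finsetSum_coeff, coeff_C_mul_X_pow]
  simp only [Finset.sum_ite_eq, Finset.mem_range]
  by_cases h : l < k + 1 <;> simp [h, jacobiShiftedCoeff]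

lemma ascPochhammer_eval_succ_left (a : ℝ) (m : ℕ) :
    (ascPochhammer ℝ (m + 1)).eval a = a * (ascPochhammer ℝ m).eval (a + 1) := by
  rw [ascPochhammer_succ_left]; simp

/-- The hypergeometric term ratio. The factor k - l vanishes at l = k, so the recursion respects the
truncation and holds for every l. -/
lemma jacobiShiftedCoeff_succ (α : ℝ) (k l : ℕ) :
    ((l : ℝ) + 1) * (l + α + 1) * jacobiShiftedCoeff α k (l + 1) =
      (k - l) * (k + l + 2 * α + 1) * jacobiShiftedCoeff α k l := by
  rcases lt_trichotomy l k with h | h | h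
  · obtain ⟨m, rfl⟩ := Nat.exists_eq_add_of_lt h
    have e1 : l + m + 1 - (l + 1) = m := by lia
    have e2 : l + m + 1 - l = m + 1 := by lia
    have hl : (l.factorial : ℝ) ≠ 0 := by positivity
    have hm : (m.factorial : ℝ) ≠ 0 := by positivity
    rw [jacobiShiftedCoeff, jacobiShiftedCoeff, if_pos (by lia), if_pos (by lia), e1, e2,
      ascPochhammer_succ_eval, ascPochhammer_eval_succ_left _ m, Nat.factorial_succ,
      Nat.factorial_succ]
    push_cast
    rw [show α + ((l : ℝ) + 1) + 1 = α + l + 1 + 1 by ring]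
    field_simp
    ring
  · subst h
    simp [jacobiShiftedCoeff]
  · simp [jacobiShiftedCoeff, show ¬ (l < k) by lia, show ¬ (l < k + 1) by lia]

lemma jacobiShiftedCoeff_derivative (α : ℝ) (k l : ℕ) :
    ((l : ℝ) + 1) * jacobiShiftedCoeff α (k + 1) (l + 1) =
      (k + 2 * α + 2) * jacobiShiftedCoeff (α + 1) k l := by
  by_cases h : l < k + 1
  · have hl : (l.factorial : ℝ) ≠ 0 := by positivity
    have hm : ((k - l).factorial : ℝ) ≠ 0 := by positivity
    rw [jacobiShiftedCoeff, jacobiShiftedCoeff, if_pos (by lia), if_pos (by lia),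
      Nat.add_sub_add_right, ascPochhammer_eval_succ_left, Nat.factorial_succ]
    push_cast
    rw [show α + ((l : ℝ) + 1) + 1 = α + 1 + l + 1 by ring,
      show (k : ℝ) + 1 + α + α + 1 + 1 = k + (α + 1) + (α + 1) + 1 by ring]
    field_simp
    ring
  · simp [jacobiShiftedCoeff, h, show ¬ (l + 1 < k + 1 + 1) by lia]

lemma derivative_jacobiShifted (α : ℝ) (k : ℕ) :
    derivative (jacobiShifted α (k + 1)) = C (k + 2 * α + 2) * jacobiShifted (α + 1) k := by
  ext l
  rw [coeff_derivative, coeff_C_mul, jacobiShifted_coeff, jacobiShifted_coeff,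
    ← jacobiShiftedCoeff_derivative, mul_comm]

lemma derivative_jacobiPoly (α : ℝ) (k : ℕ) :
    derivative (jacobiPoly α (k + 1)) = C ((k + 2 * α + 2) / 2) * jacobiPoly (α + 1) k := by
  rw [jacobiPoly, derivative_comp, derivative_jacobiShifted, jacobiPoly, mul_comp, C_comp,
    ← mul_assoc]
  congr 1
  simp only [derivative_mul, derivative_C, derivative_sub, derivative_X, derivative_one]
  rw [zero_mul, zero_add, sub_zero, mul_one, ← C_mul]
  congr 1; ring

/-- The eigenvalue of the Jacobi operator on `P_k^{(α,α)}`. -/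
def jacobiEigenvalue (α : ℝ) (k : ℕ) : ℝ := k * (k + 2 * α + 1)

/-- The Jacobi equation in t = (x-1)/2, where 1 - x² = -4t(1+t) and x = 2t+1. Comparing coefficients
of t^l reduces it to `jacobiShiftedCoeff_succ`. -/
lemma jacobiShifted_ode (α : ℝ) (k : ℕ) :
    X * (1 + X) * derivative (derivative (jacobiShifted α k)) +
      C (α + 1) * (2 * X + 1) * derivative (jacobiShifted α k) =
      C (jacobiEigenvalue α k) * jacobiShifted α k := by
  set G := jacobiShifted α k with hG
  have hr : X * (1 + X) * derivative (derivative G) + C (α + 1) * (2 * X + 1) * derivative G =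
      X * derivative (derivative G) + X * (X * derivative (derivative G)) +
        C (2 * (α + 1)) * (X * derivative G) + C (α + 1) * derivative G := by
    simp only [map_mul, map_ofNat]; ring
  rw [hr]
  ext l
  have hrec := jacobiShiftedCoeff_succ α k l
  simp only [← jacobiShifted_coeff, ← hG] at hrec
  rcases l with _ | _ | l <;>
  · simp only [coeff_add, coeff_C_mul, coeff_X_mul, coeff_X_mul_zero, coeff_derivative, zero_add,
      jacobiEigenvalue]
    push_cast at hrec ⊢
    try simp only [zero_add] at hrec ⊢
    linear_combination hrec

lemma jacobiPoly_ode (α : ℝ) (k : ℕ) (x : ℝ) :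
    jacobiOp α (fun x => (derivative (jacobiPoly α k)).eval x)
      (fun x => (derivative (derivative (jacobiPoly α k))).eval x) x =
      jacobiEigenvalue α k * (jacobiPoly α k).eval x := by
  have h := congrArg (eval (1 / 2 * (x - 1))) (jacobiShifted_ode α k)
  have hd : derivative (C (1 / 2 : ℝ) * (X - 1)) = C (1 / 2 : ℝ) := by simp
  simp only [eval_add, eval_mul, eval_X, eval_C, eval_one, eval_ofNat] at h
  simp only [jacobiOp, jacobiPoly, derivative_comp, hd, derivative_mul, derivative_C, zero_mul,
    zero_add, eval_mul, eval_C, eval_comp, eval_sub, eval_X, eval_one]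
  linear_combination h

lemma natDegree_jacobiPoly {α : ℝ} (hα : 0 ≤ α) (k : ℕ) : (jacobiPoly α k).natDegree = k := by
  have h1 : (jacobiShifted α k).natDegree = k := by
    refine natDegree_eq_of_le_of_coeff_ne_zero ?_ ?_
    · refine natDegree_le_iff_coeff_eq_zero.2 fun l hl => ?_
      rw [jacobiShifted_coeff, jacobiShiftedCoeff, if_neg (by lia)]
    · rw [jacobiShifted_coeff, jacobiShiftedCoeff, if_pos (by lia)]
      have := ascPochhammer_pos k ((k : ℝ) + α + α + 1) (by positivity)
      simp only [Nat.sub_self, ascPochhammer_zero, eval_one, Nat.factorial_zero]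
      positivity
  have h2 : (C (1 / 2 : ℝ) * (X - 1)).natDegree = 1 := by
    rw [natDegree_C_mul (by norm_num)]; exact natDegree_X_sub_C 1
  rw [jacobiPoly, natDegree_comp, h1, h2, mul_one]

lemma jacobiEigenvalue_strictMono {α : ℝ} (hα : 0 ≤ α) : StrictMono (jacobiEigenvalue α) := by
  intro j k h
  have h' : (j : ℝ) < k := by exact_mod_cast h
  have : (0 : ℝ) ≤ j := by positivity
  unfold jacobiEigenvalue
  nlinarith

/-- `P_k^{(α,α)}` is an eigenfunction of the Jacobi operator, in weak form. -/
lemma ip_jacobiOp_jacobiPoly {α : ℝ} (hα : 0 ≤ α) (k : ℕ) {f f₁ f₂ : ℝ → ℝ} (hf : HasC2 f f₁ f₂) :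
    ip α (jacobiOp α f₁ f₂) (fun x => (jacobiPoly α k).eval x) =
      jacobiEigenvalue α k * ip α f (fun x => (jacobiPoly α k).eval x) := by
  rw [ip_jacobiOp_comm hα hf (hasC2_polynomial _), ip_comm, ip_comm α f, ← ip_smul_left]
  exact ip_congr fun x _ => by rw [jacobiPoly_ode]

lemma ip_jacobiPoly_of_ne {α : ℝ} (hα : 0 ≤ α) {j k : ℕ} (h : j ≠ k) :
    ip α (fun x => (jacobiPoly α j).eval x) (fun x => (jacobiPoly α k).eval x) = 0 := by
  have e := ip_jacobiOp_jacobiPoly hα k (hasC2_polynomial (jacobiPoly α j))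
  have e' : ip α (jacobiOp α (fun x => (derivative (jacobiPoly α j)).eval x)
      (fun x => (derivative (derivative (jacobiPoly α j))).eval x))
        (fun x => (jacobiPoly α k).eval x) =
      jacobiEigenvalue α j *
        ip α (fun x => (jacobiPoly α j).eval x) (fun x => (jacobiPoly α k).eval x) := by
    rw [← ip_smul_left]
    exact ip_congr fun x _ => by rw [jacobiPoly_ode]
  rw [e'] at e
  have hne := (jacobiEigenvalue_strictMono hα).injective.ne h
  by_contra h0
  exact hne (mul_right_cancel₀ h0 e)

/-- The substitution x = 2t - 1 gives a Beta integral; this is the degree-zero norm. -/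
lemma integral_weight {α : ℝ} (hα : 0 ≤ α) :
    ∫ x in (-1 : ℝ)..1, weight α x =
      2 ^ (2 * α + 1) * (Real.Gamma (α + 1) ^ 2 / Real.Gamma (2 * α + 2)) := by
  have hb := ProbabilityTheory.beta_eq_betaIntegralReal (α + 1) (α + 1) (by linarith) (by linarith)
  have hreal : (Complex.betaIntegral ((α + 1 : ℝ) : ℂ) ((α + 1 : ℝ) : ℂ)) =
      ((∫ x in (0 : ℝ)..1, x ^ α * (1 - x) ^ α : ℝ) : ℂ) := by
    rw [Complex.betaIntegral, ← intervalIntegral.integral_ofReal]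
    refine intervalIntegral.integral_congr_Ioo_of_le (by norm_num) fun x hx => ?_
    have h0 : 0 ≤ x := hx.1.le
    have h1 : 0 ≤ 1 - x := by linarith [hx.2]
    simp only [Complex.ofReal_mul, Complex.ofReal_cpow h0, Complex.ofReal_cpow h1]
    push_cast
    simp
  rw [hreal, Complex.ofReal_re, ProbabilityTheory.beta] at hb
  have hs := intervalIntegral.integral_comp_mul_sub (a := (0 : ℝ)) (b := 1) (weight α)
    (c := 2) two_ne_zero 1
  have hc : ∫ x in (0 : ℝ)..1, weight α (2 * x - 1) =
      2 ^ (2 * α) * ∫ x in (0 : ℝ)..1, x ^ α * (1 - x) ^ α := by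
    rw [← intervalIntegral.integral_const_mul]
    refine intervalIntegral.integral_congr_Ioo_of_le (by norm_num) fun x hx => ?_
    have h0 : 0 ≤ x := hx.1.le
    have h1 : 0 ≤ 1 - x := by linarith [hx.2]
    simp only [weight]
    rw [Real.rpow_mul (by norm_num), ← Real.mul_rpow h0 h1,
      ← Real.mul_rpow (by norm_num) (by positivity)]
    congr 1; norm_num; ring
  rw [hc, ← hb] at hs
  norm_num at hs
  rw [Real.rpow_add_one (by norm_num), show 2 * α + 2 = α + 1 + (α + 1) by ring]
  linear_combination (-2) * hs

lemma jacobiNormSq_pos {α : ℝ} (hα : 0 ≤ α) (k : ℕ) : 0 < jacobiNormSq α k := by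
  have h1 := Real.Gamma_pos_of_pos (s := (k : ℝ) + α + 1) (by positivity)
  have h2 := Real.Gamma_pos_of_pos (s := (k : ℝ) + 2 * α + 1) (by positivity)
  unfold jacobiNormSq
  positivity

lemma jacobiNormSq_succ {α : ℝ} (hα : 0 ≤ α) (k : ℕ) :
    jacobiEigenvalue α (k + 1) * jacobiNormSq α (k + 1) =
      ((k + 2 * α + 2) / 2) ^ 2 * jacobiNormSq (α + 1) k := by
  have e1 : Real.Gamma (((k : ℝ) + 1) + 2 * α + 1 + 1) =
      ((k : ℝ) + 1 + 2 * α + 1) * Real.Gamma ((k : ℝ) + 1 + 2 * α + 1) :=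
    Real.Gamma_add_one (by positivity)
  have h2 := (Real.Gamma_pos_of_pos (s := (k : ℝ) + 1 + 2 * α + 1) (by positivity)).ne'
  have h3 : (k.factorial : ℝ) ≠ 0 := by positivity
  have hp : (2 : ℝ) ^ (2 * (α + 1) + 1) = 4 * 2 ^ (2 * α + 1) := by
    rw [show 2 * (α + 1) + 1 = (2 * α + 1) + (2 : ℕ) by push_cast; ring,
      Real.rpow_add_natCast (by norm_num)]
    ring
  unfold jacobiNormSq jacobiEigenvalue
  rw [Nat.factorial_succ, hp]
  push_cast
  rw [show (k : ℝ) + 2 * (α + 1) + 1 = (k : ℝ) + 1 + 2 * α + 1 + 1 by ring, e1,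
    show (k : ℝ) + (α + 1) + 1 = k + 1 + α + 1 by ring]
  have h4 : (k : ℝ) + 1 + 2 * α + 1 ≠ 0 := by positivity
  have h5 : 2 * ((k : ℝ) + 1) + 2 * α + 1 ≠ 0 := by positivity
  have h6 : 2 * (k : ℝ) + 2 * (α + 1) + 1 ≠ 0 := by positivity
  field_simp
  ring

/-- Induction on k for all α at once: `ip_jacobiOp` gives λ_{k+1}‖P_{k+1}‖² = ‖P_{k+1}'‖² with
weight ω_{α+1} on the right, and P_{k+1}' is a multiple of the degree-k polynomial for α+1. -/
lemma ip_jacobiPoly_self {α : ℝ} (hα : 0 ≤ α) (k : ℕ) :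
    ip α (fun x => (jacobiPoly α k).eval x) (fun x => (jacobiPoly α k).eval x) =
      jacobiNormSq α k := by
  induction k generalizing α with
  | zero =>
    have h : ∀ x, (jacobiPoly α 0).eval x = 1 := by
      intro x; simp [jacobiPoly_eval, jacobiP]
    have hg := (Real.Gamma_pos_of_pos (s := 2 * α + 1) (by positivity)).ne'
    have hg' := Real.Gamma_add_one (s := 2 * α + 1) (by positivity)
    rw [add_assoc, one_add_one_eq_two] at hg'
    simp only [ip, h, one_mul, integral_weight hα, hg']
    simp [jacobiNormSq]
    field_simp
  | succ k ih =>
    have h1 := ip_jacobiOp hα (hasC2_polynomial (jacobiPoly α (k + 1)))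
      (hasC2_polynomial (jacobiPoly α (k + 1)))
    rw [ip_jacobiOp_jacobiPoly hα _ (hasC2_polynomial _), derivative_jacobiPoly] at h1
    simp only [eval_mul, eval_C] at h1
    rw [ip_smul_left, ip_smul_right, ih (by linarith), ← mul_assoc, ← pow_two,
      ← jacobiNormSq_succ hα] at h1
    refine mul_left_cancel₀ ?_ h1
    unfold jacobiEigenvalue
    positivity

/-! ### Jacobi expansions: Bessel, Parseval, completeness. -/

/-- The normalized Jacobi polynomial as a polynomial. -/
def normalizedJacobiPoly (α : ℝ) (k : ℕ) : ℝ[X] :=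
  C (1 / Real.sqrt (jacobiNormSq α k)) * jacobiPoly α k

lemma normalizedJacobiPoly_eval (α : ℝ) (k : ℕ) (x : ℝ) :
    (normalizedJacobiPoly α k).eval x = normalizedJacobi α k x := by
  simp [normalizedJacobiPoly, normalizedJacobi, jacobiPoly_eval]

lemma continuous_normalizedJacobi (α : ℝ) (k : ℕ) : Continuous (normalizedJacobi α k) :=
  (normalizedJacobiPoly α k).continuous.congr (normalizedJacobiPoly_eval α k)

lemma ip_normalizedJacobi {α : ℝ} (hα : 0 ≤ α) (j k : ℕ) :
    ip α (normalizedJacobi α j) (normalizedJacobi α k) = if j = k then 1 else 0 := by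
  have e : ∀ k, normalizedJacobi α k =
      fun x => 1 / Real.sqrt (jacobiNormSq α k) * (jacobiPoly α k).eval x := fun k => by
    ext x; rw [jacobiPoly_eval]; rfl
  rw [e, e, ip_smul_left, ip_smul_right]
  split_ifs with h
  · subst h
    rw [ip_jacobiPoly_self hα]
    have := Real.sqrt_pos.2 (jacobiNormSq_pos hα j)
    field_simp
    rw [Real.sq_sqrt (jacobiNormSq_pos hα j).le]
  · rw [ip_jacobiPoly_of_ne hα h]; simp

lemma ip_jacobiOp_normalizedJacobi {α : ℝ} (hα : 0 ≤ α) (k : ℕ) {f f₁ f₂ : ℝ → ℝ}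
    (hf : HasC2 f f₁ f₂) :
    ip α (jacobiOp α f₁ f₂) (normalizedJacobi α k) =
      jacobiEigenvalue α k * ip α f (normalizedJacobi α k) := by
  have e : normalizedJacobi α k =
      fun x => 1 / Real.sqrt (jacobiNormSq α k) * (jacobiPoly α k).eval x := by
    ext x; rw [jacobiPoly_eval]; rfl
  rw [e, ip_smul_right, ip_jacobiOp_jacobiPoly hα k hf, ip_smul_right]
  ring

lemma jacobiCoeff_eq_ip (α : ℝ) (k : ℕ) (f : ℝ → ℝ) :
    jacobiCoeff α k f = ip α f (normalizedJacobi α k) := rfl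

/-- Every polynomial of degree at most `m` is a combination of the first `m + 1` normalized Jacobi
polynomials. -/
lemma exists_eq_sum_normalizedJacobi {α : ℝ} (hα : 0 ≤ α) (m : ℕ) (p : ℝ[X])
    (hp : p.natDegree ≤ m) :
    ∃ a : ℕ → ℝ, ∀ x, p.eval x = ∑ i ∈ Finset.range (m + 1), a i * normalizedJacobi α i x := by
  have hdeg : ∀ i, (normalizedJacobiPoly α i).natDegree = i := fun i => by
    have h : (1 / Real.sqrt (jacobiNormSq α i)) ≠ 0 :=
      one_div_ne_zero (Real.sqrt_pos.2 (jacobiNormSq_pos hα i)).ne'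
    rw [normalizedJacobiPoly, natDegree_C_mul h, natDegree_jacobiPoly hα]
  have hne : ∀ i, normalizedJacobiPoly α i ≠ 0 := fun i h0 => by
    have h := ip_normalizedJacobi hα i i
    have : normalizedJacobi α i = fun _ => 0 := by
      ext x; rw [← normalizedJacobiPoly_eval, h0, eval_zero]
    simp [this, ip] at h
  let S : Polynomial.Sequence ℝ :=
    { elems' := normalizedJacobiPoly α
      degree_eq' := fun i => by rw [degree_eq_natDegree (hne i), hdeg] }
  have hspan := S.span_degreeLE (m := m) fun i _ => (leadingCoeff_ne_zero.2 (S.ne_zero i)).isUnit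
  have hmem : p ∈ Polynomial.degreeLE ℝ m := mem_degreeLE.2 (natDegree_le_iff_degree_le.1 hp)
  rw [← hspan] at hmem
  refine Submodule.span_induction (p := fun q _ => ∃ a : ℕ → ℝ, ∀ x, q.eval x =
    ∑ i ∈ Finset.range (m + 1), a i * normalizedJacobi α i x) ?_ ?_ ?_ ?_ hmem
  · rintro _ ⟨j, hj, rfl⟩
    refine ⟨fun i => if i = j then 1 else 0, fun x => ?_⟩
    simp only [ite_mul, one_mul, zero_mul, Finset.sum_ite_eq', Finset.mem_range,
      Nat.lt_succ_of_le (Set.mem_Iic.1 hj), if_true]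
    exact normalizedJacobiPoly_eval α j x
  · exact ⟨fun _ => 0, fun x => by simp⟩
  · rintro p q - - ⟨a, ha⟩ ⟨b, hb⟩
    exact ⟨fun i => a i + b i, fun x => by
      rw [eval_add, ha, hb, ← Finset.sum_add_distrib]
      exact Finset.sum_congr rfl fun i _ => by ring⟩
  · rintro t p - ⟨a, ha⟩
    exact ⟨fun i => t * a i, fun x => by
      rw [eval_smul, ha, smul_eq_mul, Finset.mul_sum]
      exact Finset.sum_congr rfl fun i _ => by ring⟩

lemma continuousOn_sum_normalizedJacobi (α : ℝ) (a : ℕ → ℝ) (m : ℕ) :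
    ContinuousOn (fun x => ∑ i ∈ Finset.range m, a i * normalizedJacobi α i x) (Icc (-1) 1) :=
  (continuous_finsetSum _ fun i _ =>
    continuous_const.mul (continuous_normalizedJacobi α i)).continuousOn

lemma ip_sum_normalizedJacobi {α : ℝ} (hα : 0 ≤ α) {f : ℝ → ℝ}
    (hf : ContinuousOn f (Icc (-1) 1)) (a : ℕ → ℝ) (m : ℕ) :
    ip α f (fun x => ∑ i ∈ Finset.range m, a i * normalizedJacobi α i x) =
      ∑ i ∈ Finset.range m, a i * jacobiCoeff α i f :=
  ip_sum_right hα _ _ _ (fun i _ => (continuous_normalizedJacobi α i).continuousOn) hf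

lemma jacobiCoeff_sum_normalizedJacobi {α : ℝ} (hα : 0 ≤ α) (a : ℕ → ℝ) {j m : ℕ} (hj : j < m) :
    jacobiCoeff α j (fun x => ∑ i ∈ Finset.range m, a i * normalizedJacobi α i x) = a j := by
  rw [jacobiCoeff_eq_ip, ip_sum_left hα _ _ _
    (fun i _ => (continuous_normalizedJacobi α i).continuousOn)
    (continuous_normalizedJacobi α j).continuousOn]
  simp [ip_normalizedJacobi hα, hj]

/-- Parseval's identity for polynomials. -/
lemma ip_self_sum_normalizedJacobi {α : ℝ} (hα : 0 ≤ α) (a : ℕ → ℝ) (m : ℕ) :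
    ip α (fun x => ∑ i ∈ Finset.range m, a i * normalizedJacobi α i x)
      (fun x => ∑ i ∈ Finset.range m, a i * normalizedJacobi α i x) =
      ∑ i ∈ Finset.range m, a i ^ 2 := by
  rw [ip_sum_normalizedJacobi hα (continuousOn_sum_normalizedJacobi α a m)]
  refine Finset.sum_congr rfl fun i hi => ?_
  rw [jacobiCoeff_sum_normalizedJacobi hα a (Finset.mem_range.1 hi), pow_two]

/-- Completing the square in the a_i shows that the Jacobi coefficients give the best approximation;
Bessel and completeness both follow. -/
lemma ip_self_sub_sum_normalizedJacobi {α : ℝ} (hα : 0 ≤ α) {f : ℝ → ℝ}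
    (hf : ContinuousOn f (Icc (-1) 1)) (a : ℕ → ℝ) (m : ℕ) :
    ip α (fun x => f x - ∑ i ∈ Finset.range m, a i * normalizedJacobi α i x)
      (fun x => f x - ∑ i ∈ Finset.range m, a i * normalizedJacobi α i x) =
      ip α f f - ∑ i ∈ Finset.range m, jacobiCoeff α i f ^ 2 +
        ∑ i ∈ Finset.range m, (a i - jacobiCoeff α i f) ^ 2 := by
  have hp := continuousOn_sum_normalizedJacobi α a m
  have hs : ContinuousOn (fun x => f x - ∑ i ∈ Finset.range m, a i * normalizedJacobi α i x)
    (Icc (-1) 1) := hf.sub hp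
  rw [ip_sub_left hα hf hp hs, ip_sub_right hα hf hp hf, ip_sub_right hα hf hp hp,
    ip_self_sum_normalizedJacobi hα, 
    ip_comm α (fun x => ∑ i ∈ Finset.range m, a i * normalizedJacobi α i x) f,
    ip_sum_normalizedJacobi hα hf]
  have : ∀ i, (a i - jacobiCoeff α i f) ^ 2 =
      a i ^ 2 - 2 * (a i * jacobiCoeff α i f) + jacobiCoeff α i f ^ 2 := fun i => by ring
  simp only [this, Finset.sum_add_distrib, Finset.sum_sub_distrib, ← Finset.mul_sum]
  ring

/-- Bessel's inequality. -/
lemma sum_jacobiCoeff_sq_le {α : ℝ} (hα : 0 ≤ α) {f : ℝ → ℝ}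
    (hf : ContinuousOn f (Icc (-1) 1)) (m : ℕ) :
    ∑ i ∈ Finset.range m, jacobiCoeff α i f ^ 2 ≤ ip α f f := by
  have h := ip_self_nonneg hα (hf.sub
    (continuousOn_sum_normalizedJacobi α (fun i => jacobiCoeff α i f) m))
  have e := ip_self_sub_sum_normalizedJacobi hα hf (fun i => jacobiCoeff α i f) m
  simp only [sub_self, ne_eq, OfNat.ofNat_ne_zero, not_false_eq_true, zero_pow,
    Finset.sum_const_zero, add_zero] at e
  have h' := e ▸ h
  linarith

/-- The Jacobi expansion of a continuous function converges in `L²`. -/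
lemma exists_ip_sub_expansion_le {α : ℝ} (hα : 0 ≤ α) {f : ℝ → ℝ}
    (hf : ContinuousOn f (Icc (-1) 1)) {ε : ℝ} (hε : 0 < ε) :
    ∃ m : ℕ,
      ip α (fun x => f x - ∑ i ∈ Finset.range m, jacobiCoeff α i f * normalizedJacobi α i x)
        (fun x => f x - ∑ i ∈ Finset.range m, jacobiCoeff α i f * normalizedJacobi α i x) ≤
      ε ^ 2 * ip α (fun _ => 1) (fun _ => 1) := by
  obtain ⟨p, hp⟩ := exists_polynomial_near_of_continuousOn (-1) 1 f hf ε hε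
  obtain ⟨a, ha⟩ := exists_eq_sum_normalizedJacobi hα p.natDegree p le_rfl
  -- The partial sum of this length is at least as close to f as the Weierstrass approximant p.
  refine ⟨p.natDegree + 1, ?_⟩
  have h1 : ip α (fun x => f x - p.eval x) (fun x => f x - p.eval x) ≤
      ip α (fun _ => ε) (fun _ => ε) := by
    have hc : ContinuousOn (fun x => f x - p.eval x) (Icc (-1) 1) := hf.sub p.continuous.continuousOn
    refine ip_le_ip hα hc hc continuousOn_const continuousOn_const fun x hx => ?_
    have := hp x (Ioo_subset_Icc_self hx)
    rw [← pow_two, ← pow_two, ← sq_abs, abs_sub_comm]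
    exact pow_le_pow_left₀ (abs_nonneg _) this.le 2
  have h2 : ip α (fun _ => ε) (fun _ => ε) = ε ^ 2 * ip α (fun _ => 1) (fun _ => 1) := by
    have h := ip_smul_left α ε (fun _ => 1) (fun _ => ε * 1)
    rw [ip_smul_right α ε (fun _ => 1) (fun _ => 1), ← mul_assoc, ← pow_two] at h
    simpa only [mul_one] using h
  simp only [ha] at h1
  rw [ip_self_sub_sum_normalizedJacobi hα hf, h2] at h1
  rw [ip_self_sub_sum_normalizedJacobi hα hf]
  have h3 := Finset.sum_nonneg (s := Finset.range (p.natDegree + 1))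
    (f := fun i => (a i - jacobiCoeff α i f) ^ 2) fun i _ => sq_nonneg _
  simp only [sub_self, ne_eq, OfNat.ofNat_ne_zero, not_false_eq_true, zero_pow,
    Finset.sum_const_zero, add_zero]
  linarith

/-! ### Lower bound for the eigenvalues. -/

/-- On the orthogonal complement of the first `n` Jacobi polynomials, the Jacobi operator is bounded
below by its `n`-th eigenvalue. -/
lemma jacobiEigenvalue_mul_le_ip {α : ℝ} (hα : 0 ≤ α) {n : ℕ} {f f₁ f₂ : ℝ → ℝ}
    (hf : HasC2 f f₁ f₂) (h0 : ∀ k < n, jacobiCoeff α k f = 0) :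
    jacobiEigenvalue α n * ip α f f ≤ ip α (jacobiOp α f₁ f₂) f := by
  have hop := continuousOn_jacobiOp α hf
  have hcf : ContinuousOn (fun x => jacobiEigenvalue α n * f x) (Icc (-1) 1) :=
    continuousOn_const.mul hf.cont
  have hu : ContinuousOn (fun x => jacobiOp α f₁ f₂ x - jacobiEigenvalue α n * f x) (Icc (-1) 1) :=
    hop.sub hcf
  set u : ℝ → ℝ := fun x => jacobiOp α f₁ f₂ x - jacobiEigenvalue α n * f x with hu'
  have hsub : ∀ v, ContinuousOn v (Icc (-1) 1) →
      ip α u v = ip α (jacobiOp α f₁ f₂) v - jacobiEigenvalue α n * ip α f v := fun v hv => by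
    rw [hu', ip_sub_left hα hop hcf hv, ip_smul_left]
  -- With u = (J - λ_n)f, each partial sum p of f has ⟨u, p⟩ = Σ (λ_i - λ_n)β_i² ≥ 0, as β_i = 0 for
  -- i < n. Since p approximates f in L², ⟨u, f⟩ < 0 is impossible; no convergence of derivatives is
  -- needed.
  by_contra! hlt
  have hd : ip α u f < 0 := by rw [hsub f hf.cont]; linarith
  set W := ip α (fun _ => 1) (fun _ => 1)
  have hW : 0 ≤ W := ip_self_nonneg hα continuousOn_const
  have hK : 0 ≤ ip α u u := ip_self_nonneg hα hu
  set K := ip α u u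
  -- With this ε, Cauchy-Schwarz gives ⟨u,f⟩² ≤ Kε²W = ⟨u,f⟩² · KW/(KW+1)², which is strictly
  -- smaller than ⟨u,f⟩².
  obtain ⟨m, hm⟩ := exists_ip_sub_expansion_le hα hf.cont (ε := -ip α u f / (K * W + 1))
    (div_pos (by linarith) (by positivity))
  have hp := continuousOn_sum_normalizedJacobi α (fun i => jacobiCoeff α i f) m
  set p : ℝ → ℝ := fun x => ∑ i ∈ Finset.range m, jacobiCoeff α i f * normalizedJacobi α i x
  have hpos : 0 ≤ ip α u p := by
    rw [hsub p hp, ip_sum_normalizedJacobi hα hop, ip_sum_normalizedJacobi hα hf.cont,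
      Finset.mul_sum, ← Finset.sum_sub_distrib]
    refine Finset.sum_nonneg fun i _ => ?_
    rcases lt_or_ge i n with hi | hi
    · simp [h0 i hi]
    · rw [jacobiCoeff_eq_ip α i (jacobiOp α f₁ f₂), ip_jacobiOp_normalizedJacobi hα i hf,
        ← jacobiCoeff_eq_ip]
      nlinarith [(jacobiEigenvalue_strictMono hα).monotone hi, sq_nonneg (jacobiCoeff α i f)]
  have hfp : ContinuousOn (fun x => f x - p x) (Icc (-1) 1) := hf.cont.sub hp
  have hcs := ip_sq_le hα hu hfp
  rw [ip_sub_right hα hf.cont hp hu] at hcs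
  have h1 := hcs.trans (mul_le_mul_of_nonneg_left hm hK)
  have h2 : ip α u f ^ 2 ≤ (ip α u f - ip α u p) ^ 2 := by nlinarith
  have h3 := h2.trans h1
  rw [div_pow, neg_sq, div_mul_eq_mul_div, mul_div_assoc', le_div_iff₀ (by positivity)] at h3
  have hsq : 0 < ip α u f ^ 2 := by nlinarith
  nlinarith [mul_nonneg hK hW, mul_pos hsq (by positivity : 0 < (K * W) ^ 2 + K * W + 1)]

/-- The potential terms cancel in the symmetry identity for J, leaving (χ - χ')⟨f, g⟩ = 0. -/
lemma IsEigenfunction.ip_eq_zero {c α χ χ' : ℝ} (hα : 0 ≤ α) {f g : ℝ → ℝ}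
    (hf : IsEigenfunction c α χ f) (hg : IsEigenfunction c α χ' g) (h : χ ≠ χ') :
    ip α f g = 0 := by
  obtain ⟨f₁, f₂, hf2, hfe⟩ := hf.hasC2
  obtain ⟨g₁, g₂, hg2, hge⟩ := hg.hasC2
  have hc : ∀ t : ℝ, ContinuousOn (fun x : ℝ => t - c ^ 2 * x ^ 2) (Icc (-1) 1) := fun t => by
    fun_prop
  have e := ip_jacobiOp_comm hα hf2 hg2
  have hfc : ContinuousOn (fun x => (χ - c ^ 2 * x ^ 2) * f x) (Icc (-1) 1) := (hc χ).mul hf2.cont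
  have hgc : ContinuousOn (fun x => (χ' - c ^ 2 * x ^ 2) * f x) (Icc (-1) 1) :=
    (hc χ').mul hf2.cont
  rw [ip_congr (f' := fun x => (χ - c ^ 2 * x ^ 2) * f x) (g' := g)
      fun x hx => by rw [hfe x hx],
    ip_congr (f := f) (f' := fun x => (χ' - c ^ 2 * x ^ 2) * f x) (g' := g)
      fun x hx => by rw [hge x hx]; ring, ← sub_eq_zero, ← ip_sub_left hα hfc hgc hg2.cont,
    ip_congr (f' := fun x => (χ - χ') * f x) (g' := g) fun x _ => by ring, ip_smul_left] at e
  exact (mul_eq_zero.1 e).resolve_left (sub_ne_zero.2 h)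

/-- The `n`-th eigenvalue is at least the `n`-th eigenvalue of the Jacobi operator. -/
lemma IsNthEigenvalue.jacobiEigenvalue_le {c α χ : ℝ} (hα : 0 ≤ α) {n : ℕ}
    (h : IsNthEigenvalue c α n χ) : jacobiEigenvalue α n ≤ χ := by
  obtain ⟨hχ, hcard⟩ := h
  have hfin : {χ' | χ' ∈ eigenvalues c α ∧ χ' < χ}.Finite := Set.finite_of_encard_eq_coe hcard
  -- The n+1 eigenvalues up to and including χ.
  set T : Finset ℝ := insert χ hfin.toFinset with hT
  have hTcard : T.card = n + 1 := by
    rw [hT, Finset.card_insert_of_notMem (by simp)]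
    rw [hfin.encard_eq_coe_toFinset_card] at hcard
    rw [Nat.cast_injective hcard]
  have hTle : ∀ i ∈ T, i ≤ χ := fun i hi => by
    rcases Finset.mem_insert.1 hi with rfl | hi
    · exact le_rfl
    · exact ((hfin.mem_toFinset).1 hi).2.le
  have hTeig : ∀ i : T, ∃ f, IsEigenfunction c α i f := fun ⟨i, hi⟩ => by
    rcases Finset.mem_insert.1 hi with rfl | hi
    · exact hχ
    · exact ((hfin.mem_toFinset).1 hi).1
  choose F hF using hTeig
  choose F₁ F₂ hF2 hFe using fun i => (hF i).hasC2
  let M : Matrix (Fin n) T ℝ := fun k i => jacobiCoeff α k (F i)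
  -- n orthogonality conditions on n+1 unknowns have a nonzero solution.
  have hker : LinearMap.ker M.mulVecLin ≠ ⊥ := LinearMap.ker_ne_bot_of_finrank_lt (by
    simp [hTcard])
  obtain ⟨a, ha, ha0⟩ := Submodule.exists_mem_ne_zero_of_ne_bot hker
  have hFc : ∀ i ∈ (Finset.univ : Finset T), ContinuousOn (F i) (Icc (-1) 1) :=
    fun i _ => (hF2 i).cont
  have hg := HasC2.sum Finset.univ a hF2
  have hcoeff : ∀ k < n, jacobiCoeff α k (fun x => ∑ i, a i * F i x) = 0 := fun k hk => by
    rw [jacobiCoeff_eq_ip, ip_sum_left hα _ _ _ hFc (continuous_normalizedJacobi α k).continuousOn]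
    have := congrFun (LinearMap.mem_ker.1 ha) ⟨k, hk⟩
    refine Eq.trans ?_ this
    exact Finset.sum_congr rfl fun i _ => by rw [mul_comm]; rfl
  have hdiag : ∀ b : T → ℝ, ip α (fun x => ∑ i, b i * F i x) (fun x => ∑ i, a i * F i x) =
      ∑ i, b i * a i * ip α (F i) (F i) := fun b => by
    rw [ip_sum_left hα _ _ _ hFc hg.cont]
    refine Finset.sum_congr rfl fun i _ => ?_
    rw [ip_sum_right hα _ _ _ hFc (hF2 i).cont, Finset.sum_eq_single i, mul_assoc]
    · intro j _ hj
      rw [(hF i).ip_eq_zero hα (hF j) fun h => hj (Subtype.ext h.symm), mul_zero]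
    · simp
  have hFpos : ∀ i, 0 < ip α (F i) (F i) := fun i => ip_self_pos hα (hF2 i).cont (hF i).ne_zero
  have hpos : 0 < ip α (fun x => ∑ i, a i * F i x) (fun x => ∑ i, a i * F i x) := by
    rw [hdiag]
    obtain ⟨i, hi⟩ := Function.ne_iff.1 ha0
    exact Finset.sum_pos' (fun j _ => mul_nonneg (mul_self_nonneg _) (hFpos j).le)
      ⟨i, Finset.mem_univ i, mul_pos (mul_self_pos.2 hi) (hFpos i)⟩
  -- The Rayleigh quotient of the combination is at most χ: drop the potential c²x² ≥ 0, then use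
  -- orthogonality of the eigenfunctions.
  have hupper : ip α (jacobiOp α (fun x => ∑ i, a i * F₁ i x) (fun x => ∑ i, a i * F₂ i x))
      (fun x => ∑ i, a i * F i x) ≤
      χ * ip α (fun x => ∑ i, a i * F i x) (fun x => ∑ i, a i * F i x) := by
    have hb : ContinuousOn (fun x => ∑ i : T, (i * a i) * F i x) (Icc (-1) 1) :=
      continuousOn_finsetSum _ fun i _ => continuousOn_const.mul (hF2 i).cont
    refine (ip_le_ip hα (continuousOn_jacobiOp α hg) hg.cont hb hg.cont fun x hx => ?_).trans ?_
    · have e : jacobiOp α (fun x => ∑ i, a i * F₁ i x) (fun x => ∑ i, a i * F₂ i x) x =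
          ∑ i : T, (i * a i) * F i x - c ^ 2 * x ^ 2 * ∑ i, a i * F i x := by
        simp only [jacobiOp, Finset.mul_sum, ← Finset.sum_add_distrib, ← Finset.sum_sub_distrib]
        refine Finset.sum_congr rfl fun i _ => ?_
        have := hFe i x hx
        rw [jacobiOp] at this
        linear_combination a i * this
      rw [e, sub_mul]
      have : 0 ≤ c ^ 2 * x ^ 2 * (∑ i, a i * F i x) * ∑ i, a i * F i x := by
        rw [mul_assoc]
        exact mul_nonneg (by positivity) (mul_self_nonneg _)
      linarith
    · rw [hdiag, hdiag, Finset.mul_sum]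
      refine Finset.sum_le_sum fun i _ => ?_
      nlinarith [mul_le_mul_of_nonneg_right (hTle i i.2)
        (mul_nonneg (mul_self_nonneg (a i)) (hFpos i).le)]
  exact le_of_mul_le_mul_right ((jacobiEigenvalue_mul_le_ip hα hg hcoeff).trans hupper) hpos

/-! ### Decay of the low coefficients. -/

/-- The low Jacobi coefficients of an eigenfunction are controlled by slightly more of them. -/
lemma IsEigenfunction.sum_jacobiCoeff_sq_le {c α χ : ℝ} (hα : 0 ≤ α) {f : ℝ → ℝ}
    (hf : IsEigenfunction c α χ f) {k : ℕ} (hk : jacobiEigenvalue α k ≤ χ) :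
    (χ - jacobiEigenvalue α k) ^ 2 * ∑ i ∈ Finset.range (k + 1), jacobiCoeff α i f ^ 2 ≤
      c ^ 4 * ∑ i ∈ Finset.range (k + 3), jacobiCoeff α i f ^ 2 := by
  obtain ⟨f₁, f₂, hf2, hfe⟩ := hf.hasC2
  set b : ℕ → ℝ := fun i => jacobiCoeff α i f with hb
  change _ * ∑ i ∈ Finset.range (k + 1), b i ^ 2 ≤ _ * ∑ i ∈ Finset.range (k + 3), b i ^ 2
  set S := ∑ i ∈ Finset.range (k + 1), b i ^ 2 with hS
  set S' := ∑ i ∈ Finset.range (k + 3), b i ^ 2 with hS'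
  have hxf : ContinuousOn (fun x => x ^ 2 * f x) (Icc (-1) 1) :=
    (continuousOn_id.pow 2).mul hf2.cont
  have hχf : ContinuousOn (fun x => χ * f x) (Icc (-1) 1) := continuousOn_const.mul hf2.cont
  have hcxf : ContinuousOn (fun x => c ^ 2 * (x ^ 2 * f x)) (Icc (-1) 1) :=
    continuousOn_const.mul hxf
  have hrec : ∀ i, (χ - jacobiEigenvalue α i) * b i =
      c ^ 2 * jacobiCoeff α i (fun x => x ^ 2 * f x) := fun i => by
    have h := ip_jacobiOp_normalizedJacobi hα i hf2
    rw [ip_congr (f' := fun x => χ * f x - c ^ 2 * (x ^ 2 * f x)) (g' := normalizedJacobi α i)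
      fun x hx => by rw [hfe x hx]; ring,
      ip_sub_left hα hχf hcxf (continuous_normalizedJacobi α i).continuousOn, ip_smul_left,
      ip_smul_left] at h
    simp only [hb, jacobiCoeff_eq_ip]
    linarith
  have hp := continuousOn_sum_normalizedJacobi α b (k + 1)
  -- The a_i are the coefficients of x²p, where p is the truncation of f at degree k; they stop at
  -- index k+2.
  obtain ⟨a, ha⟩ := exists_eq_sum_normalizedJacobi hα (k + 2)
    (X ^ 2 * ∑ i ∈ Finset.range (k + 1), C (b i) * normalizedJacobiPoly α i) (by
      refine natDegree_mul_le.trans ?_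
      have : (∑ i ∈ Finset.range (k + 1), C (b i) * normalizedJacobiPoly α i).natDegree ≤ k := by
        refine natDegree_sum_le_of_forall_le _ _ fun i hi => ?_
        refine (natDegree_C_mul_le _ _).trans ((natDegree_C_mul_le _ _).trans ?_)
        rw [natDegree_jacobiPoly hα]
        have := Finset.mem_range.1 hi
        lia
      rw [natDegree_X_pow]
      lia)
  simp only [eval_mul, eval_pow, eval_X, eval_finsetSum, eval_C, normalizedJacobiPoly_eval] at ha
  have hsum : (χ - jacobiEigenvalue α k) * S ≤
      c ^ 2 * ∑ i ∈ Finset.range (k + 3), a i * b i := by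
    have e1 : ∑ i ∈ Finset.range (k + 3), a i * b i =
        ∑ i ∈ Finset.range (k + 1), b i * jacobiCoeff α i (fun x => x ^ 2 * f x) := by
      rw [← ip_sum_normalizedJacobi hα hf2.cont, ← ip_sum_normalizedJacobi hα hxf]
      refine ip_congr fun x _ => ?_
      rw [← ha]; ring
    rw [e1, hS, Finset.mul_sum, Finset.mul_sum]
    refine Finset.sum_le_sum fun i hi => ?_
    have hmono := (jacobiEigenvalue_strictMono hα).monotone
      (Nat.lt_succ_iff.1 (Finset.mem_range.1 hi))
    have h1 := hrec i
    nlinarith [mul_le_mul_of_nonneg_right hmono (sq_nonneg (b i)), congrArg (b i * ·) h1]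
  -- Parseval and x⁴ ≤ 1: multiplication by x² does not increase the norm.
  have ha2 : ∑ i ∈ Finset.range (k + 3), a i ^ 2 ≤ S := by
    rw [← ip_self_sum_normalizedJacobi hα, hS, ← ip_self_sum_normalizedJacobi hα]
    have hc := continuousOn_sum_normalizedJacobi α a (k + 3)
    refine ip_le_ip hα hc hc hp hp fun x hx => ?_
    rw [← ha]
    have h0 := one_sub_sq_pos hx
    nlinarith [mul_self_nonneg (∑ i ∈ Finset.range (k + 1), b i * normalizedJacobi α i x),
      mul_nonneg (mul_nonneg h0.le (by positivity : 0 ≤ 1 + x ^ 2))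
        (mul_self_nonneg (∑ i ∈ Finset.range (k + 1), b i * normalizedJacobi α i x))]
  have hcs := Finset.sum_mul_sq_le_sq_mul_sq (Finset.range (k + 3)) a b
  have hS0 : 0 ≤ S := Finset.sum_nonneg fun i _ => sq_nonneg _
  have hS0' : 0 ≤ S' := Finset.sum_nonneg fun i _ => sq_nonneg _
  -- Squaring the bounds leaves a common factor S to cancel, so S = 0 is treated apart.
  rcases hS0.eq_or_lt with h0 | h0
  · rw [← h0, mul_zero]; positivity
  · have h1 : ((χ - jacobiEigenvalue α k) * S) ^ 2 ≤
        (c ^ 2 * ∑ i ∈ Finset.range (k + 3), a i * b i) ^ 2 :=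
      pow_le_pow_left₀ (mul_nonneg (sub_nonneg.2 hk) hS0) hsum 2
    have h2 : (∑ i ∈ Finset.range (k + 3), a i * b i) ^ 2 ≤ S * S' :=
      hcs.trans (mul_le_mul_of_nonneg_right ha2 hS0')
    refine le_of_mul_le_mul_right ?_ h0
    have h3 := mul_le_mul_of_nonneg_left h2 (by positivity : 0 ≤ c ^ 4)
    nlinarith

lemma IsGPSWF.sum_jacobiCoeff_sq_le_exp {c α : ℝ} (hα : 0 ≤ α) {n : ℕ} {ψ : ℝ → ℝ}
    (h : IsGPSWF c α n ψ) (hn : 3 * c ^ 2 ≤ n) (d m : ℕ) (hm : m + 2 * d ≤ n + 1) :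
    ∑ i ∈ Finset.range (m + 1), jacobiCoeff α i ψ ^ 2 ≤ Real.exp (-2 * d) := by
  obtain ⟨⟨χ, hχ, hψ⟩, hnorm⟩ := h
  induction d generalizing m with
  | zero =>
    have hb := GPSWF.sum_jacobiCoeff_sq_le hα hψ.contDiffOn.continuousOn (m + 1)
    have : ip α ψ ψ = 1 := by simpa only [ip, ← pow_two] using hnorm
    simpa [this] using hb
  | succ d ih =>
    have hmn : m + 1 ≤ n := by lia
    have hmn' : (m : ℝ) + 1 ≤ n := by exact_mod_cast hmn
    have hm0 : (0 : ℝ) ≤ m := by positivity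
    -- λ_n - λ_m = (n-m)(n+m+2α+1), and n - m ≥ 1.
    have hgap : (n : ℝ) ≤ χ - jacobiEigenvalue α m := by
      have := hχ.jacobiEigenvalue_le hα
      unfold jacobiEigenvalue at *
      nlinarith
    have hstep := hψ.sum_jacobiCoeff_sq_le hα (k := m) (by linarith [hm0])
    have hih := ih (m + 2) (by lia)
    rw [show m + 2 + 1 = m + 3 by ring] at hih
    set S := ∑ i ∈ Finset.range (m + 1), jacobiCoeff α i ψ ^ 2
    set S' := ∑ i ∈ Finset.range (m + 3), jacobiCoeff α i ψ ^ 2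
    have hS0 : 0 ≤ S := Finset.sum_nonneg fun i _ => sq_nonneg _
    have hS0' : 0 ≤ S' := Finset.sum_nonneg fun i _ => sq_nonneg _
    have h1 : (n : ℝ) ^ 2 * S ≤ c ^ 4 * S' :=
      (mul_le_mul_of_nonneg_right (pow_le_pow_left₀ (by positivity) hgap 2) hS0).trans hstep
    have h2 : 9 * c ^ 4 ≤ (n : ℝ) ^ 2 := by
      have := pow_le_pow_left₀ (by positivity) hn 2
      nlinarith
    have hn0 : (0 : ℝ) < (n : ℝ) ^ 2 := by
      have : (0 : ℝ) < n := by linarith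
      positivity
    have h3 : 9 * S ≤ S' := by
      refine le_of_mul_le_mul_left ?_ hn0
      nlinarith [mul_le_mul_of_nonneg_right h2 hS0']
    have he : Real.exp 2 ≤ 9 := by
      have e3 : Real.exp 1 ≤ 3 := by linarith [Real.exp_one_lt_d9]
      rw [show (2 : ℝ) = 1 + 1 by norm_num, Real.exp_add]
      nlinarith [Real.exp_pos 1]
    have h4 : Real.exp 2 * S ≤ Real.exp (-2 * d) := by nlinarith
    have h5 : Real.exp (-2 * d) = Real.exp 2 * Real.exp (-2 * ((d + 1 : ℕ) : ℝ)) := by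
      rw [← Real.exp_add]; congr 1; push_cast; ring
    rw [h5] at h4
    exact le_of_mul_le_mul_left h4 (Real.exp_pos 2)

lemma IsGPSWF.abs_jacobiCoeff_le_exp {c α : ℝ} (hα : 0 ≤ α) {n k : ℕ} {ψ : ℝ → ℝ}
    (h : IsGPSWF c α n ψ) (hn : 3 * c ^ 2 ≤ n) (hk : k ≤ n) :
    |jacobiCoeff α k ψ| ≤ Real.exp (-((n : ℝ) - k) / 2) := by
  -- d = ⌈(n-k)/2⌉ is the number of steps of length 2 from k to n; rounding up is why the preceding
  -- lemma allows n + 1.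
  obtain ⟨d, hd1, hd2⟩ : ∃ d : ℕ, k + 2 * d ≤ n + 1 ∧ n ≤ k + 2 * d :=
    ⟨(n + 1 - k) / 2, by lia, by lia⟩
  have h1 := h.sum_jacobiCoeff_sq_le_exp hα hn d k hd1
  have h2 := Finset.single_le_sum (f := fun i => jacobiCoeff α i ψ ^ 2)
    (fun i _ => sq_nonneg _) (Finset.mem_range.2 (Nat.lt_succ_self k))
  have hd : (n : ℝ) ≤ k + 2 * d := by exact_mod_cast hd2
  refine abs_le_of_sq_le_sq (h2.trans (h1.trans ?_)) (Real.exp_pos _).le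
  rw [← Real.exp_nat_mul]
  refine Real.exp_le_exp.2 ?_
  push_cast
  linarith

lemma IsGPSWF.abs_jacobiCoeff_le_one {c α : ℝ} (hα : 0 ≤ α) {n : ℕ} {ψ : ℝ → ℝ}
    (h : IsGPSWF c α n ψ) (k : ℕ) : |jacobiCoeff α k ψ| ≤ 1 := by
  obtain ⟨⟨χ, -, hψ⟩, hnorm⟩ := h
  have h1 := GPSWF.sum_jacobiCoeff_sq_le hα hψ.contDiffOn.continuousOn (k + 1)
  have h2 := Finset.single_le_sum (f := fun i => jacobiCoeff α i ψ ^ 2)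
    (fun i _ => sq_nonneg _) (Finset.mem_range.2 (Nat.lt_succ_self k))
  have h3 : ip α ψ ψ = 1 := by simpa only [ip, ← pow_two] using hnorm
  exact abs_le_of_sq_le_sq (by rw [one_pow, ← h3]; exact h2.trans h1) zero_le_one

end GPSWF

end

theorem mainTheorem5 :
    ∃ δ : ℝ, 0 < δ ∧ ∀ c α : ℝ, 1 < c → 0 < α →
      ∃ C : ℝ, 0 < C ∧ ∀ (n k : ℕ) (ψ : ℝ → ℝ), GPSWF.IsGPSWF c α n ψ →
        (k : ℝ) ≤ (n : ℝ) / 1.9 → GPSWF.mConst α * c ≤ (n : ℝ) →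
          |GPSWF.jacobiCoeff α k ψ| ≤ C * Real.exp (-δ * (n : ℝ)) := by
  -- For k ≤ n/1.9, (n-k)/2 ≥ (9/38)n ≥ n/5. For n < 3c² the factor exp(3c²) makes the right side at
  -- least 1, and Bessel's bound is enough.
  refine ⟨1 / 5, by norm_num, fun c α _ hα => ⟨Real.exp (3 * c ^ 2), Real.exp_pos _,
    fun n k ψ hψ hk _ => ?_⟩⟩
  have hn0 : (0 : ℝ) ≤ n := by positivity
  rw [le_div_iff₀ (by norm_num)] at hk
  rw [← Real.exp_add]
  rcases le_or_gt (3 * c ^ 2) (n : ℝ) with hn | hn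
  · have hkn : k ≤ n := by
      have : (k : ℝ) ≤ n := by
        have : (0 : ℝ) ≤ k := by positivity
        linarith
      exact_mod_cast this
    refine (hψ.abs_jacobiCoeff_le_exp hα.le hn hkn).trans (Real.exp_le_exp.2 ?_)
    nlinarith [sq_nonneg c]
  · refine (hψ.abs_jacobiCoeff_le_one hα.le k).trans (Real.one_le_exp ?_)
    linarith
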